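/- Let $R$ be an associative ring with identity. Suppose that $R$ is of bounded index, that is, there is $m\in\mathbb{N}$ such that $x^m=0$ for every nilpotent $x\in R$, and that $R$ is strongly 2-nil-clean, that is, every $a\in R$ can be written as $a=e+f+w$ with $e^2=e$, $f^2=f$, $w$ nilpotent, and $e,f,w$ commuting pairwise. Then for every $n\in\mathbb{N}$ the matrix ring $M_n(R)$ is trinil clean, that is, every $A\in M_n(R)$ can be written as $A=E+W$ with $E=E^3$ and $W$ nilpotent in $M_n(R)$. -/

import Mathlib

/-- An element `e` of a ring is a tripotent if `e = e ^ 3`. -/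
def IsTripotentElem {R : Type*} [Ring R] (e : R) : Prop :=
  e = e ^ 3

/-- A ring is trinil clean if every element is the sum of a tripotent and a nilpotent
(which need not commute). -/
def IsTrinilClean (R : Type*) [Ring R] : Prop :=
  ∀ a : R, ∃ e w : R, IsTripotentElem e ∧ IsNilpotent w ∧ a = e + w

/-- A ring is strongly 2-nil-clean if every element is the sum of two idempotents and a
nilpotent that commute with one another. -/
def IsStronglyTwoNilClean (R : Type*) [Ring R] : Prop :=
  ∀ a : R, ∃ e f w : R, IsIdempotentElem e ∧ IsIdempotentElem f ∧ IsNilpotent w ∧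
    Commute e f ∧ Commute e w ∧ Commute f w ∧ a = e + f + w

/-- A ring is of bounded index if a single exponent annihilates all its nilpotent elements. -/
def IsOfBoundedIndex (R : Type*) [Ring R] : Prop :=
  ∃ m : ℕ, ∀ x : R, IsNilpotent x → x ^ m = 0

/-! Every `a - a ^ 3` is nilpotent in `R`. This makes the Jacobson radical `J` nil and puts every
square-zero element inside it, so `R ⧸ J` is reduced, satisfies `a ^ 3 = a`, and is commutative.
Bounded index gives `J` one common nil exponent, so `J` lies in every semiprime ideal, and hence
every matrix over `J` is nilpotent (`isNilpotent_of_mem_matrix`).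

It remains to decompose matrices over `R ⧸ J` and lift. The target is nilpotent plus `p - q` with
`p`, `q` orthogonal idempotents: such pairs lift modulo a nil ideal, and `p - q` is tripotent. The
entries of one matrix generate a finite subring, a product of fields with elements `0`, `1`, `-1`.
Over such a field, block triangular form reduces to companion matrices (`isOrthNilClean_of_cyclic`).
-/

/-! ### Rings in which every `a - a ^ 3` is nilpotent, and their Jacobson radical. -/

section CubeSubSelf

variable {R : Type*} [Ring R]

/-- A sum of two commuting idempotents is a root of `t (t - 1) (t - 2)`; at `t = 3 - w` this makes
`6` a multiple of `w`. -/
theorem IsStronglyTwoNilClean.isNilpotent_six (hs : IsStronglyTwoNilClean R) :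
    IsNilpotent (6 : R) := by
  obtain ⟨e, f, w, he, hf, hw, hef, hew, hfw, h⟩ := hs 3
  have h3 : (3 : R) - w = e + f := by rw [h]; abel
  have key : ((3 : R) - w) * ((3 - w) - 1) * ((3 - w) - 2) = 0 := by
    rw [h3]
    have he' : e * e = e := he
    have hf' : f * f = f := hf
    have hfe : f * e = e * f := hef.eq.symm
    have e1 : ∀ t, e * (e * t) = e * t := fun t => by rw [← mul_assoc, he']
    have h2 : (2 : R) = 1 + 1 := by norm_num
    rw [h2]
    simp only [mul_add, add_mul, mul_sub, sub_mul, mul_assoc, he', hf', hfe, e1, mul_one]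
    abel
  have h6 : (6 : R) = w * (11 - 6 * w + w ^ 2) := by
    have : ((3 : R) - w) * ((3 - w) - 1) * ((3 - w) - 2) = 6 - w * (11 - 6 * w + w ^ 2) := by
      have h2 : (2 : R) = 1 + 1 := by norm_num
      have h6 : (6 : R) = 1 + 1 + 1 + 1 + 1 + 1 := by norm_num
      have h11 : (11 : R) = 6 + (1 + 1 + 1 + 1 + 1) := by norm_num
      have h3 : (3 : R) = 1 + 1 + 1 := by norm_num
      rw [h11, h6, h3, h2]
      noncomm_ring
    rw [this] at key
    exact sub_eq_zero.mp key
  rw [h6]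
  refine Commute.isNilpotent_mul_right ?_ hw
  exact (((Nat.cast_commute 11 w).symm.sub_right
    ((Nat.cast_commute 6 w).symm.mul_right (Commute.refl w))).add_right
    ((Commute.refl w).pow_right 2))

/-- With `g = e + f`, `g - g ^ 3 = -6ef` is nilpotent because `6` is; the remaining terms are
multiples of `w`, and everything commutes. -/
theorem IsStronglyTwoNilClean.isNilpotent_sub_cube (hs : IsStronglyTwoNilClean R) (a : R) :
    IsNilpotent (a - a ^ 3) := by
  obtain ⟨e, f, w, he, hf, hw, hef, hew, hfw, rfl⟩ := hs a
  have he' : e * e = e := he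
  have hf' : f * f = f := hf
  have hfe : f * e = e * f := hef.eq.symm
  have e1 : ∀ t, e * (e * t) = e * t := fun t => by rw [← mul_assoc, he']
  have hgw : Commute (e + f) w := hew.add_left hfw
  have hg : (e + f) - (e + f) ^ 3 = -(6 * (e * f)) := by
    have h6 : (6 : R) = 1 + 1 + 1 + 1 + 1 + 1 := by norm_num
    rw [h6]
    simp only [pow_succ, pow_zero, one_mul, mul_add, add_mul, mul_assoc, he', hf', hfe, e1]
    abel
  have hsum : (e + f + w) - (e + f + w) ^ 3
      = -(6 * (e * f)) + w * (1 - 3 * (e + f) ^ 2 - 3 * ((e + f) * w) - w ^ 2) := by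
    rw [← hg]
    generalize e + f = g at hgw
    have c1 : g * w = w * g := hgw.eq
    have c2 : ∀ t, g * (w * t) = w * (g * t) := fun t => by rw [← mul_assoc, c1, mul_assoc]
    have h3 : (3 : R) = 1 + 1 + 1 := by norm_num
    rw [h3]
    simp only [pow_succ, pow_zero, one_mul, mul_add, add_mul, mul_sub, mul_assoc, c1, c2, mul_one]
    abel
  have n1 : IsNilpotent (-(6 * (e * f))) :=
    ((Nat.cast_commute 6 (e * f)).isNilpotent_mul_right hs.isNilpotent_six).neg
  have cw : Commute w (1 - 3 * (e + f) ^ 2 - 3 * ((e + f) * w) - w ^ 2) := by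
    have h3 : Commute w (3 : R) := (Nat.cast_commute 3 w).symm
    exact (((Commute.one_right w).sub_right (h3.mul_right (hgw.symm.pow_right 2))).sub_right
      (h3.mul_right (hgw.symm.mul_right (Commute.refl w)))).sub_right ((Commute.refl w).pow_right 2)
  have n2 := cw.isNilpotent_mul_right hw
  rw [hsum]
  refine Commute.isNilpotent_add ?_ n1 n2
  have h6 : ∀ t : R, Commute (6 : R) t := fun t => Nat.cast_commute 6 t
  have h3 : ∀ t : R, Commute t (3 : R) := fun t => (Nat.cast_commute 3 t).symm
  have hefw : Commute (e * f) w := hew.mul_left hfw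
  have hefg : Commute (e * f) (e + f) :=
    ((Commute.refl e).mul_left hef.symm).add_right (hef.mul_left (Commute.refl f))
  refine Commute.neg_left ((h6 _).mul_left (hefw.mul_right ?_))
  exact (((Commute.one_right _).sub_right ((h3 _).mul_right (hefg.pow_right 2))).sub_right
      ((h3 _).mul_right (hefg.mul_right hefw))).sub_right (hefw.pow_right 2)

/-- A nonzero idempotent `x * z` with `x * x = 0` would generate a copy of `2 × 2` matrix units, in
which `e₁₁ + e₁₂ + e₂₁` violates the hypothesis. -/
theorem IsIdempotentElem.mul_eq_zero_of_isNilpotent_sub_cube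
    (h : ∀ a : R, IsNilpotent (a - a ^ 3)) {x z : R} (hx : x * x = 0)
    (he : IsIdempotentElem (x * z)) : x * z = 0 := by
  obtain ⟨y, hy, hxy⟩ : ∃ y, y * (x * y) = y ∧ x * y = x * z := by
    have he' : x * z * (x * z) = x * z := he
    refine ⟨z * (x * z), ?_, ?_⟩
    · calc z * (x * z) * (x * (z * (x * z)))
          = z * ((x * z) * (x * z) * (x * z)) := by simp only [mul_assoc]
        _ = z * (x * z) := by rw [he', he']
    · rw [← mul_assoc, he']
  rw [← hxy]
  have hx1 : ∀ t, x * (x * t) = 0 := fun t => by rw [← mul_assoc, hx, zero_mul]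
  have hy1 : ∀ t, y * (x * (y * t)) = y * t := fun t => by
    rw [← mul_assoc x, ← mul_assoc y, hy]
  obtain ⟨a, i, haa, hai, hia, hii, hfi⟩ : ∃ a i : R, a * a = a + i ∧ a * i = a ∧ i * a = a ∧
      i * i = i ∧ y * x * i = y * x := by
    -- Matrix units: `e₁₁ = xy(1 - yx)`, `e₁₂ = xyx`, `e₂₁ = y(1 - yx)`, `e₂₂ = yx`. Then `a = e₁₁ +
    -- e₁₂ + e₂₁` and `i = e₁₁ + e₂₂`.
    refine ⟨x * y - x * y * (y * x) + x * y * x + y - y * (y * x),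
      x * y - x * y * (y * x) + y * x, ?_, ?_, ?_, ?_, ?_⟩
    all_goals
      simp only [mul_add, add_mul, mul_sub, sub_mul, mul_assoc, hx1, hy, hy1, mul_zero, sub_zero,
        add_zero, zero_add]
      try abel
  have hna : IsNilpotent a := by
    have h1 : a - a ^ 3 = -(a ^ 2) := by
      rw [pow_succ, pow_two, haa, add_mul, haa, hia]; abel
    have h2 := (h a)
    rw [h1] at h2
    exact (isNilpotent_neg_iff.mp h2).of_pow
  have hni : IsNilpotent i := by
    have : i = a * (a - 1) := by rw [mul_sub, haa, mul_one]; abel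
    rw [this]
    exact ((Commute.refl a).sub_right (Commute.one_right a)).isNilpotent_mul_right hna
  have hi0 : i = 0 := by
    obtain ⟨n, hn⟩ := hni
    have : IsIdempotentElem i := hii
    rw [← this.pow_succ_eq n, pow_succ, hn, zero_mul]
  have hyx : y * x = 0 := by rw [← hfi, hi0, mul_zero]
  rw [← hy, ← mul_assoc y, hyx, zero_mul, mul_zero]

/-- For `c = (xy)²`, `c - c²` is nilpotent, so some polynomial in `c` is idempotent. It lies in
`xR`, hence vanishes by the previous lemma, and this forces `c` to be nilpotent. -/
theorem isNilpotent_mul_of_mul_self_eq_zero (h : ∀ a : R, IsNilpotent (a - a ^ 3)) {x : R}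
    (hx : x * x = 0) (y : R) : IsNilpotent (x * y) := by
  set b := x * y with hb
  have hc : IsNilpotent (b ^ 2 - (b ^ 2) ^ 2) := by
    have : b ^ 2 - (b ^ 2) ^ 2 = b * (b - b ^ 3) := by noncomm_ring
    rw [this]
    exact ((Commute.refl b).sub_right ((Commute.refl b).pow_right 3)).isNilpotent_mul_left (h b)
  obtain ⟨n, hn⟩ := hc
  have hn' : (b ^ 2 - (b ^ 2) ^ 2) ^ (n + 1) = 0 := by rw [pow_succ, hn, zero_mul]
  set c := b ^ 2 with hcdef
  have hid := isIdempotentElem_one_sub_one_sub_pow_pow c (n + 1) hn'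
  have hxc : x ∣ c ^ (n + 1) := by
    rw [pow_succ', hcdef, hb, pow_two, mul_assoc x, mul_assoc x]
    exact dvd_mul_right _ _
  have hxe : x ∣ 1 - (1 - c ^ (n + 1)) ^ (n + 1) := by
    refine hxc.trans ?_
    have := (Commute.one_left (1 - c ^ (n + 1))).sub_dvd_pow_sub_pow (n + 1)
    rwa [one_pow, sub_sub_cancel] at this
  obtain ⟨z, hz⟩ := hxe
  rw [hz] at hid
  have h0 := hid.mul_eq_zero_of_isNilpotent_sub_cube h hx
  rw [← hz, sub_eq_zero] at h0
  have hcn : c ^ (n + 1) = 0 := by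
    have hcom : Commute c (1 - c ^ (n + 1)) :=
      (Commute.one_right c).sub_right ((Commute.refl c).pow_right _)
    obtain ⟨r, hr⟩ : (c - c ^ 2) ∣ c * (1 - c ^ (n + 1)) := by
      have := (Commute.one_left c).sub_dvd_pow_sub_pow (n + 1)
      rw [one_pow] at this
      obtain ⟨r, hr⟩ := this
      exact ⟨r, by rw [hr, ← mul_assoc, mul_sub, mul_one, pow_two]⟩
    have hcr : (1 - c ^ (n + 1)) = (1 - c) * ∑ i ∈ Finset.range (n + 1), c ^ i := by
      rw [mul_neg_geom_sum]
    have hcs : Commute (c - c ^ 2) (∑ i ∈ Finset.range (n + 1), c ^ i) :=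
      Commute.sum_right _ _ _ fun i _ =>
        ((Commute.refl c).sub_left ((Commute.refl c).pow_left 2)).pow_right i
    calc c ^ (n + 1) = c ^ (n + 1) * (1 - c ^ (n + 1)) ^ (n + 1) := by rw [← h0, mul_one]
      _ = (c * (1 - c ^ (n + 1))) ^ (n + 1) := (hcom.mul_pow _).symm
      _ = ((c - c ^ 2) * ∑ i ∈ Finset.range (n + 1), c ^ i) ^ (n + 1) := by
          rw [hcr, ← mul_assoc, mul_sub, mul_one, ← pow_two]
      _ = 0 := by rw [hcs.mul_pow, hn', zero_mul]
  exact IsNilpotent.of_pow (m := 2) ⟨n + 1, hcn⟩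

theorem mem_jacobson_of_mul_self_eq_zero (h : ∀ a : R, IsNilpotent (a - a ^ 3)) {x : R}
    (hx : x * x = 0) : x ∈ Ring.jacobson R := by
  rw [← Ideal.jacobson_bot, Ideal.mem_jacobson_iff]
  intro y
  have hyx : IsNilpotent (y * x) := by
    obtain ⟨n, hn⟩ := isNilpotent_mul_of_mul_self_eq_zero h hx y
    have hyn : ∀ k, (y * x) ^ (k + 1) = y * (x * y) ^ k * x := by
      intro k
      induction k with
      | zero => simp
      | succ k ih => rw [pow_succ, ih, pow_succ]; simp only [mul_assoc]
    exact ⟨n + 1, by rw [hyn, hn, mul_zero, zero_mul]⟩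
  obtain ⟨u, hu⟩ := hyx.isUnit_one_add
  refine ⟨(↑u⁻¹ : R), ?_⟩
  rw [Ideal.mem_bot]
  have : (↑u⁻¹ : R) * (1 + y * x) = 1 := by rw [← hu, Units.inv_mul]
  rw [mul_assoc]
  rw [mul_add, mul_one] at this
  rw [add_comm, this, sub_self]

/-- Here `1 - x²` is left invertible and `(1 - x²)ⁿ xⁿ = (x - x³)ⁿ`. -/
theorem isNilpotent_of_mem_jacobson (h : ∀ a : R, IsNilpotent (a - a ^ 3)) {x : R}
    (hx : x ∈ Ring.jacobson R) : IsNilpotent x := by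
  rw [← Ideal.jacobson_bot, Ideal.mem_jacobson_iff] at hx
  obtain ⟨z, hz⟩ := hx (-x)
  rw [Ideal.mem_bot] at hz
  have hz' : z * (1 - x ^ 2) = 1 := by
    rw [← sub_eq_zero, ← hz]; noncomm_ring
  obtain ⟨n, hn⟩ := h x
  have hcom : Commute (1 - x ^ 2) x := (Commute.one_left x).sub_left ((Commute.refl x).pow_left 2)
  have hn' : (1 - x ^ 2) ^ n * x ^ n = 0 := by
    rw [← hcom.mul_pow, ← hn]; congr 1; noncomm_ring
  refine ⟨n, ?_⟩
  have : ∀ k, z ^ k * (1 - x ^ 2) ^ k = 1 := by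
    intro k
    induction k with
    | zero => simp
    | succ k ih => rw [pow_succ, pow_succ', mul_assoc, ← mul_assoc z (1 - x ^ 2), hz', one_mul, ih]
  rw [← one_mul (x ^ n), ← this n, mul_assoc, hn', mul_zero]

theorem cube_eq_self_quotient_jacobson (h : ∀ a : R, IsNilpotent (a - a ^ 3))
    (a : R ⧸ Ring.jacobson R) : a ^ 3 = a := by
  have hK : ∀ a : R ⧸ Ring.jacobson R, IsNilpotent (a - a ^ 3) := by
    intro a
    obtain ⟨a, rfl⟩ := Ideal.Quotient.mk_surjective a
    simpa using (h a).map (Ideal.Quotient.mk (Ring.jacobson R))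
  have hred : IsReduced (R ⧸ Ring.jacobson R) := by
    rw [isReduced_iff_pow_one_lt 2 one_lt_two]
    intro x hx
    have := mem_jacobson_of_mul_self_eq_zero hK (x := x) (by rwa [← pow_two])
    rwa [Ring.jacobson_quotient_jacobson, Ideal.mem_bot] at this
  exact (sub_eq_zero.mp (hK a).eq_zero).symm

/-- The ring is reduced, so idempotents are central, in particular all squares. Cubing `a + a²`
gives `3(a + a²) = 0`, which expresses `a` through squares. -/
theorem mul_comm_of_cube_eq_self (h : ∀ a : R, a ^ 3 = a) (a b : R) : a * b = b * a := by
  have hsq : ∀ w : R, w * w = 0 → w = 0 := fun w hw => by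
    rw [← h w, pow_succ, pow_two, hw, zero_mul]
  have hidem : ∀ e r : R, e * e = e → e * r = r * e := by
    intro e r he
    have he1 : ∀ t, e * (e * t) = e * t := fun t => by rw [← mul_assoc, he]
    have h1 : e * r - e * r * e = 0 := hsq _ (by
      simp only [mul_sub, sub_mul, mul_assoc, he1]; abel)
    have h2 : r * e - e * r * e = 0 := hsq _ (by
      simp only [mul_sub, sub_mul, mul_assoc, he1]; abel)
    rw [sub_eq_zero.mp h1, sub_eq_zero.mp h2]
  have hcsq : ∀ a r : R, a ^ 2 * r = r * a ^ 2 := fun a r => hidem _ r (by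
    calc a ^ 2 * a ^ 2 = a ^ 3 * a := by noncomm_ring
      _ = a ^ 2 := by rw [h, pow_two])
  have h3 : 3 * (a + a ^ 2) = 0 := by
    have e4 : a ^ 4 = a ^ 2 := by rw [pow_succ, h, pow_two]
    have e5 : a ^ 5 = a := by rw [pow_succ, e4, ← pow_succ, h]
    have e6 : a ^ 6 = a ^ 2 := by rw [pow_succ, e5, pow_two]
    have : (a + a ^ 2) ^ 3 = a ^ 3 + 3 * a ^ 4 + 3 * a ^ 5 + a ^ 6 := by noncomm_ring
    rw [h, h, e4, e5, e6] at this
    have h' : 3 * (a + a ^ 2) = (a + 3 * a ^ 2 + 3 * a + a ^ 2) - (a + a ^ 2) := by noncomm_ring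
    rw [h', ← this, sub_self]
  have ha : a = 1 + 2 * a ^ 2 - (a + 1) ^ 2 - 2 * (a ^ 2 + a ^ 2) + (3 * (a + a ^ 2)) := by
    noncomm_ring
  rw [h3, add_zero] at ha
  have hc1 := hcsq a b
  have hc2 := hcsq (a + 1) b
  have h2 : ∀ t, t * (2 : R) = 2 * t := fun t => (Nat.cast_commute 2 t).eq.symm
  rw [ha]
  simp only [add_mul, sub_mul, mul_add, mul_sub, one_mul, mul_one, mul_assoc, hc1, hc2]
  simp only [← mul_assoc, h2]

end CubeSubSelf

/-! ### Matrices over a nil ideal of bounded index. -/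

section BoundedNil

variable {R : Type*} [Ring R]

/-- Put `x = s + say` in `h` and expand. As `asasa = 0`, a factor `sa` survives only in last place,
leaving `a(saya)ʲsa + a(saya)ʲ⁺¹`. The second term vanishes by `h` at `say`. -/
theorem mul_pow_eq_zero_step {a s : R} {j : ℕ} (h : ∀ x, a * (x * a) ^ (j + 1) = 0)
    (hs : a * s * a * (s * a) = 0) (y : R) :
    (a * s * a) * (y * (a * s * a)) ^ j = 0 := by
  have hs1 : ∀ t, a * (s * (a * (s * (a * t)))) = 0 := fun t => by
    simpa only [mul_assoc, zero_mul] using congrArg (· * t) hs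
  have hs0 : a * (s * (a * (s * a))) = 0 := by simpa only [mul_assoc] using hs
  have key : ∀ i, a * ((s + s * a * y) * a) ^ (i + 1)
      = a * (s * a * y * a) ^ i * (s * a + s * a * y * a) := by
    intro i
    induction i with
    | zero => simp only [zero_add, pow_one, pow_zero, mul_one, add_mul]
    | succ i ih =>
      rw [pow_succ, ← mul_assoc, ih]
      have hz : ∀ t, a * (s * a * y * a) ^ i * (s * (a * (s * (a * t)))) = 0 := by
        intro t
        cases i with
        | zero => simp only [pow_zero, mul_one, hs1]
        | succ i => rw [pow_succ]; simp only [mul_assoc, hs1, mul_zero]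
      have hz0 : a * (s * a * y * a) ^ i * (s * (a * (s * a))) = 0 := by
        cases i with
        | zero => simp only [pow_zero, mul_one, hs0]
        | succ i => rw [pow_succ]; simp only [mul_assoc, hs0, mul_zero]
      rw [pow_succ, ← mul_assoc a]
      generalize a * (s * a * y * a) ^ i = c at *
      simp only [mul_add, add_mul, mul_assoc] at hz hz0 ⊢
      rw [hz0, hz (y * a)]
      abel
  have h1 : a * (s * a * y * a) ^ (j + 1) = 0 := h (s * a * y)
  have h2 := key j
  rw [h, mul_add, mul_assoc a _ (s * a * y * a), ← pow_succ, h1, add_zero] at h2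
  have h3 : ∀ i, (s * a * y * a) ^ i * (s * a) = s * a * (y * (a * s * a)) ^ i := by
    have : SemiconjBy (s * a) (y * (a * s * a)) (s * a * y * a) := by
      simp only [SemiconjBy, mul_assoc]
    exact fun i => (this.pow_right i).eq.symm
  rw [mul_assoc a, h3] at h2
  rw [h2]
  simp only [mul_assoc]

/-- A semiprime ring satisfies no identity `b * (x * b) ^ k = 0` with `b ≠ 0`. -/
theorem eq_zero_of_forall_mul_mul_pow_eq_zero
    (hsp : ∀ b : R, (∀ x, b * x * b = 0) → b = 0) (k : ℕ) :
    ∀ b : R, (∀ x, b * (x * b) ^ k = 0) → b = 0 := by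
  induction k with
  | zero => intro b h; simpa using h 0
  | succ k ih =>
    intro a h
    cases k with
    | zero => exact hsp a fun x => by simpa [mul_assoc] using h x
    | succ j =>
      -- The induction hypothesis serves twice: for `b = a(xa)ʲ⁺¹`, via the step lemma with `s =
      -- (xa)ʲx`, and then for `a` itself.
      refine ih a fun x => ?_
      have hb : a * ((x * a) ^ j * x) * a = a * (x * a) ^ (j + 1) := by
        rw [pow_succ]; simp only [mul_assoc]
      rw [← hb]
      refine ih _ (mul_pow_eq_zero_step h ?_)
      rw [hb]
      have : (x * a) ^ j * x * a = (x * a) ^ (j + 1) := by rw [pow_succ, mul_assoc]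
      rw [this, mul_assoc, ← pow_add, show j + 1 + (j + 1) = j + 1 + 1 + j by ring, pow_add,
        ← mul_assoc, h, zero_mul]

/-- A nil ideal of bounded index lies in every semiprime ideal. -/
theorem mem_of_bounded_nil {I P : Ideal R} [I.IsTwoSided] [P.IsTwoSided] {m : ℕ}
    (hI : ∀ x ∈ I, x ^ m = 0) (hP : ∀ b : R, (∀ x, b * x * b ∈ P) → b ∈ P) : I ≤ P := by
  intro b hb
  rw [← Ideal.Quotient.eq_zero_iff_mem]
  refine eq_zero_of_forall_mul_mul_pow_eq_zero (R := R ⧸ P) ?_ m _ ?_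
  · intro b hb
    obtain ⟨b, rfl⟩ := Ideal.Quotient.mk_surjective b
    rw [Ideal.Quotient.eq_zero_iff_mem]
    refine hP b fun x => ?_
    rw [← Ideal.Quotient.eq_zero_iff_mem]
    simpa using hb (Ideal.Quotient.mk P x)
  · intro x
    obtain ⟨x, rfl⟩ := Ideal.Quotient.mk_surjective x
    rw [← map_mul, ← map_pow, hI _ (I.mul_mem_left x hb), map_zero, mul_zero]

/-- `P` is maximal among two-sided ideals over which no power of `A` has all its entries. Zorn
applies because a matrix has finitely many entries. -/
theorem exists_semiprime_of_not_isNilpotent {n : Type*} [Fintype n] [DecidableEq n]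
    {A : Matrix n n R} (hA : ¬ IsNilpotent A) :
    ∃ P : Ideal R, P.IsTwoSided ∧ (∀ b : R, (∀ x, b * x * b ∈ P) → b ∈ P) ∧
      ∀ k, A ^ k ∉ P.matrix n := by
  let S : Set (Ideal R) := {P | P.IsTwoSided ∧ ∀ k, A ^ k ∉ P.matrix n}
  obtain ⟨P, -, hP⟩ := zorn_le_nonempty₀ S (fun c hcS hc P hPc => by
    have hmem : ∀ {x}, x ∈ sSup c ↔ ∃ Q ∈ c, x ∈ Q :=
      Submodule.mem_sSup_of_directed ⟨P, hPc⟩ hc.directedOn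
    refine ⟨sSup c, ⟨⟨fun b hx => ?_⟩, fun k hk => ?_⟩, fun Q hQ => le_sSup hQ⟩
    · obtain ⟨Q, hQ, hx⟩ := hmem.mp hx
      have := (hcS hQ).1
      exact hmem.mpr ⟨Q, hQ, Q.mul_mem_right b hx⟩
    · have h1 : ∀ ij : n × n, ∃ Q ∈ c, (A ^ k) ij.1 ij.2 ∈ Q := fun ij => hmem.mp (hk ij.1 ij.2)
      choose f hf hf' using h1
      obtain ⟨Q, hQ, hle⟩ : ∃ Q ∈ c, ∀ ij ∈ (Finset.univ : Finset (n × n)), f ij ≤ Q := by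
        generalize (Finset.univ : Finset (n × n)) = s
        induction s using Finset.induction_on with
        | empty => exact ⟨P, hPc, by simp⟩
        | insert a s _ ih =>
          obtain ⟨Q, hQ, h⟩ := ih
          obtain ⟨Q', hQ', h1, h2⟩ := hc.directedOn Q hQ (f a) (hf a)
          refine ⟨Q', hQ', fun ij hij => ?_⟩
          rcases Finset.mem_insert.mp hij with rfl | hij
          · exact h2
          · exact (h ij hij).trans h1
      exact (hcS hQ).2 k fun i j => hle (i, j) (Finset.mem_univ _) (hf' (i, j)))
    ⊥ ⟨inferInstance, fun k hk => hA ⟨k, by simpa [Ideal.matrix_bot] using hk⟩⟩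
  obtain ⟨hP2, hPA⟩ := hP.1
  refine ⟨P, hP2, fun b hb => ?_, hPA⟩
  by_contra hbP
  have large : ∀ L : Ideal R, L.IsTwoSided → P ≤ L → b ∈ L → ∃ k, A ^ k ∈ L.matrix n := by
    intro L hL hPL hbL
    by_contra! hcon
    exact hbP (hP.2 (y := L) ⟨hL, hcon⟩ hPL hbL)
  -- Both `L` and `L'` contain `P` and `b`, so by maximality each contains the entries of a power of
  -- `A`; `L * L' ≤ P` then contradicts the choice of `P`.
  let L : Ideal R :=
    { carrier := {x | ∀ r, x * r * b ∈ P}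
      add_mem' := fun {x y} hx hy r => by rw [add_mul, add_mul]; exact P.add_mem (hx r) (hy r)
      zero_mem' := fun r => by simp
      smul_mem' := fun c x hx r => by
        rw [smul_eq_mul, mul_assoc c, mul_assoc c]; exact P.mul_mem_left c (hx r) }
  let L' : Ideal R :=
    { carrier := {y | ∀ x ∈ L, ∀ r, x * r * y ∈ P}
      add_mem' := fun {y z} hy hz x hx r => by
        rw [mul_add]; exact P.add_mem (hy x hx r) (hz x hx r)
      zero_mem' := fun x _ r => by simp
      smul_mem' := fun c y hy x hx r => by
        rw [smul_eq_mul, ← mul_assoc, mul_assoc x]; exact hy x hx _ }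
  obtain ⟨k, hk⟩ := large L ⟨fun {x} t hx r => by rw [mul_assoc x]; exact hx _⟩
    (fun x hx r => P.mul_mem_right _ (P.mul_mem_right _ hx)) hb
  obtain ⟨l, hl⟩ := large L' ⟨fun {y} t hy x hx r => by
      rw [← mul_assoc]; exact P.mul_mem_right _ (hy x hx r)⟩
    (fun y hy x _ r => P.mul_mem_left _ hy) (fun x hx r => hx r)
  refine hPA (k + l) fun i j => ?_
  rw [pow_add, Matrix.mul_apply]
  refine P.sum_mem fun t _ => ?_
  simpa using hl t j _ (hk i t) 1

theorem isNilpotent_of_mem_matrix {n : Type*} [Fintype n] [DecidableEq n] {I : Ideal R}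
    [I.IsTwoSided] {m : ℕ} (hI : ∀ x ∈ I, x ^ m = 0) {A : Matrix n n R} (hA : A ∈ I.matrix n) :
    IsNilpotent A := by
  by_contra hcon
  obtain ⟨P, hP2, hP, hPA⟩ := exists_semiprime_of_not_isNilpotent hcon
  refine hPA 1 fun i j => ?_
  rw [pow_one]
  exact mem_of_bounded_nil hI hP (hA i j)

end BoundedNil

/-! ### The decomposition that lifts. -/

/-- The element `a` is the sum of a nilpotent and a difference of orthogonal idempotents. -/
def IsOrthNilClean {S : Type*} [Ring S] (a : S) : Prop :=
  ∃ p q : S, IsIdempotentElem p ∧ IsIdempotentElem q ∧ p * q = 0 ∧ q * p = 0 ∧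
    IsNilpotent (a - (p - q))

theorem IsOrthNilClean.map {S T F : Type*} [Ring S] [Ring T] [FunLike F S T] [RingHomClass F S T]
    (f : F) {a : S} (h : IsOrthNilClean a) : IsOrthNilClean (f a) := by
  obtain ⟨p, q, hp, hq, hpq, hqp, hn⟩ := h
  refine ⟨f p, f q, hp.map f, hq.map f, ?_, ?_, ?_⟩
  · rw [← map_mul, hpq, map_zero]
  · rw [← map_mul, hqp, map_zero]
  · simpa using hn.map f

theorem IsNilpotent.isOrthNilClean {S : Type*} [Ring S] {a : S} (h : IsNilpotent a) :
    IsOrthNilClean a :=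
  ⟨0, 0, .zero, .zero, by simp, by simp, by simpa using h⟩

/-! ### Block triangular and companion endomorphisms. -/

section LinearMap

variable {F : Type*} [Field F]

/-- Block triangular endomorphisms inherit the decomposition from their diagonal blocks. -/
theorem IsOrthNilClean.of_prod {U V : Type*} [AddCommGroup U] [Module F U] [AddCommGroup V]
    [Module F V] {B : Module.End F (U × V)} {C : Module.End F U} {D : Module.End F V}
    (hC : ∀ u, B (u, 0) = (C u, 0)) (hD : ∀ x, (B x).2 = D x.2)
    (h₁ : IsOrthNilClean C) (h₂ : IsOrthNilClean D) : IsOrthNilClean B := by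
  obtain ⟨p, q, hp, hq, hpq, hqp, k, hk⟩ := h₁
  obtain ⟨p', q', hp', hq', hpq', hqp', l, hl⟩ := h₂
  refine ⟨p.prodMap p', q.prodMap q', ?_, ?_, ?_, ?_, k + l, ?_⟩
  · rw [IsIdempotentElem, LinearMap.prodMap_mul, hp.eq, hp'.eq]
  · rw [IsIdempotentElem, LinearMap.prodMap_mul, hq.eq, hq'.eq]
  · rw [LinearMap.prodMap_mul, hpq, hpq', LinearMap.prodMap_zero]
  · rw [LinearMap.prodMap_mul, hqp, hqp', LinearMap.prodMap_zero]
  · set W := B - (p.prodMap p' - q.prodMap q') with hW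
    have hWC : ∀ i u, (W ^ i) (u, 0) = (((C - (p - q)) ^ i) u, 0) := by
      intro i
      induction i with
      | zero => intro u; simp
      | succ i ih =>
        intro u
        rw [pow_succ, pow_succ, Module.End.mul_apply, Module.End.mul_apply, ← ih]
        congr 1
        simp [hW, hC]
    have hWD : ∀ i x, ((W ^ i) x).2 = ((D - (p' - q')) ^ i) x.2 := by
      intro i
      induction i with
      | zero => intro x; simp
      | succ i ih =>
        intro x
        rw [pow_succ, pow_succ, Module.End.mul_apply, Module.End.mul_apply, ih]
        congr 1
        simp [hW, hD]
    apply LinearMap.ext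
    intro x
    have h2 : (W ^ l) x = (((W ^ l) x).1, 0) := by
      refine Prod.ext rfl ?_
      rw [hWD, hl, LinearMap.zero_apply]
    rw [pow_add, Module.End.mul_apply, h2, hWC, hk]
    rfl

variable {V : Type*} [AddCommGroup V] [Module F V]

theorem LinearMap.isNilpotent_of_span {W : Module.End F V} {s : Set V}
    (hs : Submodule.span F s = ⊤) (k : ℕ) (h : ∀ x ∈ s, (W ^ k) x = 0) : IsNilpotent W :=
  ⟨k, LinearMap.ext_on hs fun x hx => by rw [h x hx, LinearMap.zero_apply]⟩

theorem smulRight_mul_smulRight (φ ψ : V →ₗ[F] F) (x y : V) :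
    (φ.smulRight x : Module.End F V) * (ψ.smulRight y) = φ y • ψ.smulRight x := by
  ext z
  simp [smul_smul, mul_comm]

/-- Companion matrices of nonzero trace `±1`. -/
theorem isOrthNilClean_of_cyclic_of_ne_zero {A : Module.End F V} {v : V} {k : ℕ} {φ : V →ₗ[F] F}
    (hspan : Submodule.span F ((fun i => (A ^ i) v) '' Set.Iic k) = ⊤)
    (hφ : ∀ i < k, φ ((A ^ i) v) = 0) (hφk : φ ((A ^ k) v) = 1)
    (ht : φ ((A ^ (k + 1)) v) = 1 ∨ φ ((A ^ (k + 1)) v) = -1) : IsOrthNilClean A := by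
  set e := fun i => (A ^ i) v with he
  -- `E` carries the last column of the companion matrix, so `A - E` is a nilpotent shift, and `E *
  -- E` is `E` times the trace.
  set E : Module.End F V := φ.smulRight (e (k + 1)) with hE
  have hAe : ∀ i, A (e i) = e (i + 1) := fun i => by
    simp only [he]; rw [pow_succ', Module.End.mul_apply]
  change ∀ i < k, φ (e i) = 0 at hφ
  change φ (e k) = 1 at hφk
  change φ (e (k + 1)) = 1 ∨ φ (e (k + 1)) = -1 at ht
  have hWapp : ∀ x, (A - E) x = A x - φ x • e (k + 1) := fun x => by simp [hE]
  have hEE : E * E = φ (e (k + 1)) • E := smulRight_mul_smulRight _ _ _ _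
  have hnil : IsNilpotent (A - E) := by
    have hW : ∀ i ≤ k, ((A - E) ^ i) (e 0) = e i := by
      intro i
      induction i with
      | zero => simp
      | succ i ih =>
        intro hi
        rw [pow_succ', Module.End.mul_apply, ih (by omega)]
        rw [hWapp, hAe, hφ i (by omega), zero_smul, sub_zero]
    have hW' : ((A - E) ^ (k + 1)) (e 0) = 0 := by
      rw [pow_succ', Module.End.mul_apply, hW k le_rfl]
      rw [hWapp, hAe, hφk, one_smul, sub_self]
    refine LinearMap.isNilpotent_of_span hspan (k + 1) ?_
    rintro _ ⟨i, hi, rfl⟩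
    rw [← hW i hi, ← Module.End.mul_apply, ← pow_add, add_comm, pow_add, Module.End.mul_apply, hW',
      map_zero]
  rcases ht with ht | ht
  · refine ⟨E, 0, ?_, .zero, by simp, by simp, by simpa using hnil⟩
    rw [IsIdempotentElem, hEE, ht, one_smul]
  · refine ⟨0, -E, .zero, ?_, by simp, by simp, by simpa using hnil⟩
    rw [IsIdempotentElem, neg_mul_neg, hEE, ht, neg_one_smul]

/-- Companion matrices of trace zero, given a suitable correction vector `h`. -/
theorem isOrthNilClean_of_cyclic_of_eq_zero {A : Module.End F V} {v h : V} {m : ℕ}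
    {φ ψ : V →ₗ[F] F}
    (hspan : Submodule.span F ((fun i => (A ^ i) v) '' Set.Iic (m + 1)) = ⊤)
    (hφ : ∀ i < m + 1, φ ((A ^ i) v) = 0) (hφk : φ ((A ^ (m + 1)) v) = 1)
    (hψ : ∀ i < m, ψ ((A ^ i) v) = 0) (hψm : ψ ((A ^ m) v) = 1) (hψl : ψ ((A ^ (m + 1)) v) = 0)
    (ht : φ ((A ^ (m + 2)) v) = 0) (hφh : φ h = 0) (hψh : ψ h = 0)
    (hAh : A h = (ψ ((A ^ (m + 2)) v) + 1) • (A ^ m) v) : IsOrthNilClean A := by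
  set e := fun i => (A ^ i) v with he
  have hAe : ∀ i, A (e i) = e (i + 1) := fun i => by
    simp only [he]; rw [pow_succ', Module.End.mul_apply]
  change ∀ i < m + 1, φ (e i) = 0 at hφ
  change φ (e (m + 1)) = 1 at hφk
  change ∀ i < m, ψ (e i) = 0 at hψ
  change ψ (e m) = 1 at hψm
  change ψ (e (m + 1)) = 0 at hψl
  change φ (e (m + 2)) = 0 at ht
  change A h = (ψ (e (m + 2)) + 1) • e m at hAh
  set s := ψ (e (m + 2)) + 1 with hs
  have hφm : φ (e m) = 0 := hφ m (by omega)
  set p := e m + h with hp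
  -- `q` is chosen so that `W (W (e m)) = 0` for the remainder `W` below; the value of `s` gives `ψ
  -- q = 0`.
  set q := e (m + 2) - e (m + 1) - s • e m + p with hq
  have hφp : φ p = 0 := by simp [hp, hφm, hφh]
  have hψp : ψ p = 1 := by simp [hp, hψm, hψh]
  have hφq : φ q = -1 := by simp [hq, ht, hφk, hφm, hφp]
  have hψq : ψ q = 0 := by simp [hq, hψl, hψm, hψp, hs]
  refine ⟨ψ.smulRight p, -φ.smulRight q, ?_, ?_, ?_, ?_, ?_⟩
  · rw [IsIdempotentElem, smulRight_mul_smulRight, hψp, one_smul]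
  · rw [IsIdempotentElem, neg_mul_neg, smulRight_mul_smulRight, hφq, neg_one_smul]
  · rw [mul_neg, smulRight_mul_smulRight, hψq, zero_smul, neg_zero]
  · rw [neg_mul, smulRight_mul_smulRight, hφp, zero_smul, neg_zero]
  · set W : Module.End F V := A - (ψ.smulRight p - -φ.smulRight q) with hWdef
    have hWapp : ∀ x, W x = A x - ψ x • p - φ x • q := fun x => by
      simp [hWdef]; abel
    have hWe : ∀ i ≤ m, (W ^ i) (e 0) = e i := by
      intro i
      induction i with
      | zero => simp
      | succ i ih =>
        intro hi
        rw [pow_succ', Module.End.mul_apply, ih (by omega), hWapp, hAe, hφ i (by omega),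
          hψ i (by omega)]
        simp
    have hWm : W (e m) = e (m + 1) - p := by rw [hWapp, hAe, hψm, hφm]; simp
    have hWh : W h = s • e m := by rw [hWapp, hAh, hψh, hφh]; simp
    have hWl : W (e (m + 1)) = e (m + 2) - q := by rw [hWapp, hAe, hψl, hφk]; simp
    have hW2 : W (W (e m)) = 0 := by
      rw [hWm, map_sub, hWl, hp, map_add, hWm, hWh, hq, hp]; abel
    have hem : ∀ j, (W ^ (j + 2)) (e m) = 0 := fun j => by
      rw [pow_add, Module.End.mul_apply, pow_two, Module.End.mul_apply, hW2, map_zero]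
    refine LinearMap.isNilpotent_of_span hspan (m + 3) ?_
    rintro _ ⟨i, hi, rfl⟩
    rcases Nat.lt_or_ge i (m + 1) with hi' | hi'
    · obtain ⟨d, rfl⟩ := Nat.exists_eq_add_of_le (Nat.le_of_lt_succ hi')
      rw [show i + d + 3 = (i + 1 + 2) + d by ring, ← hWe i (by omega), pow_add,
        Module.End.mul_apply, ← Module.End.mul_apply (W ^ d), ← pow_add, add_comm d,
        hWe _ le_rfl, hem]
    · obtain rfl : i = m + 1 := le_antisymm hi hi'
      have hl : e (m + 1) = W (e m) + e m + h := by rw [hWm, hp]; abel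
      rw [hl, map_add, map_add, ← Module.End.mul_apply, ← pow_succ, show m + 3 + 1 = m + 2 + 2 by ring,
        hem, hem, show m + 3 = (m + 2) + 1 by ring, pow_succ (W) (m + 2), Module.End.mul_apply, hWh,
        map_smul, hem]
      simp

end LinearMap

/-! ### From cyclic endomorphisms to all matrices over a field with elements `0`, `1`, `-1`. -/

section Cyclic

variable {F : Type*} [Field F]

theorem isOrthNilClean_of_mul_self_eq_one {V : Type*} [AddCommGroup V] [Module F V]
    {A : Module.End F V} (hA : A * A = 1) (h2 : (2 : F) ≠ 0) : IsOrthNilClean A := by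
  have h4 : (2 : F)⁻¹ * 2⁻¹ * 2 = 2⁻¹ := by field_simp
  refine ⟨(2 : F)⁻¹ • (1 + A), (2 : F)⁻¹ • (1 - A), ?_, ?_, ?_, ?_, ?_⟩
  · rw [IsIdempotentElem, smul_mul_smul_comm]
    have : (1 + A) * (1 + A) = (2 : F) • (1 + A) := by
      rw [two_smul, mul_add, add_mul, add_mul, hA]; noncomm_ring
    rw [this, smul_smul, h4]
  · rw [IsIdempotentElem, smul_mul_smul_comm]
    have : (1 - A) * (1 - A) = (2 : F) • (1 - A) := by
      rw [two_smul, mul_sub, sub_mul, sub_mul, hA]; noncomm_ring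
    rw [this, smul_smul, h4]
  · rw [smul_mul_smul_comm, show (1 + A) * (1 - A) = 1 - A * A by noncomm_ring, hA, sub_self,
      smul_zero]
  · rw [smul_mul_smul_comm, show (1 - A) * (1 + A) = 1 - A * A by noncomm_ring, hA, sub_self,
      smul_zero]
  · rw [← smul_sub, show (1 + A) - (1 - A) = (2 : F) • A by rw [two_smul]; abel, smul_smul,
      inv_mul_cancel₀ h2, one_smul, sub_self]
    exact .zero

theorem isOrthNilClean_of_cyclic (hF : ∀ a : F, a = 0 ∨ a = 1 ∨ a = -1)
    {V : Type*} [AddCommGroup V] [Module F V] {A : Module.End F V} {v : V} {k : ℕ}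
    (hli : LinearIndependent F fun i : Fin (k + 1) => (A ^ (i : ℕ)) v)
    (hspan : Submodule.span F (Set.range fun i : Fin (k + 1) => (A ^ (i : ℕ)) v) = ⊤) :
    IsOrthNilClean A := by
  set b := Module.Basis.mk hli hspan.ge with hb
  have hbe : ∀ i, b i = (A ^ (i : ℕ)) v := fun i => Module.Basis.mk_apply hli hspan.ge i
  have hcoord : ∀ j (hj : j < k + 1) i, i < k + 1 →
      b.coord ⟨j, hj⟩ ((A ^ i) v) = if i = j then 1 else 0 := by
    intro j hj i hi
    have := hbe ⟨i, hi⟩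
    simp only at this
    rw [← this, Module.Basis.coord_apply, Module.Basis.repr_self, Finsupp.single_apply]
    simp
  have hspan' : Submodule.span F ((fun i => (A ^ i) v) '' Set.Iic k) = ⊤ := by
    rw [← hspan]
    congr 1
    ext x
    constructor
    · rintro ⟨i, hi, rfl⟩
      exact ⟨⟨i, Nat.lt_succ_of_le hi⟩, rfl⟩
    · rintro ⟨i, rfl⟩
      exact ⟨i, Nat.le_of_lt_succ i.2, rfl⟩
  have hφ : ∀ i < k, b.coord ⟨k, k.lt_succ_self⟩ ((A ^ i) v) = 0 := fun i hi => by
    rw [hcoord _ _ _ (by omega), if_neg hi.ne]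
  have hφk : b.coord ⟨k, k.lt_succ_self⟩ ((A ^ k) v) = 1 := by
    rw [hcoord _ _ _ (by omega), if_pos rfl]
  rcases hF (b.coord ⟨k, k.lt_succ_self⟩ ((A ^ (k + 1)) v)) with ht | ht
  swap
  · exact isOrthNilClean_of_cyclic_of_ne_zero hspan' hφ hφk ht
  rcases k with _ | m
  · refine IsNilpotent.isOrthNilClean (LinearMap.isNilpotent_of_span hspan' 1 ?_)
    rintro _ ⟨i, hi, rfl⟩
    obtain rfl : i = 0 := Nat.le_zero.mp hi
    have h := b.sum_repr (A v)
    rw [Fin.sum_univ_one] at h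
    have ht' : b.repr (A v) 0 = 0 := by simpa using ht
    rw [ht', zero_smul] at h
    simpa using h.symm
  set φ := b.coord ⟨m + 1, (m + 1).lt_succ_self⟩
  set ψ := b.coord ⟨m, by omega⟩ with hψdef
  have hψ : ∀ i < m, ψ ((A ^ i) v) = 0 := fun i hi => by
    rw [hcoord _ _ _ (by omega), if_neg hi.ne]
  have hψm : ψ ((A ^ m) v) = 1 := by
    rw [hcoord _ _ _ (by omega), if_pos rfl]
  have hψl : ψ ((A ^ (m + 1)) v) = 0 := by
    rw [hcoord _ _ _ (by omega), if_neg (by omega)]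
  set c := ψ ((A ^ (m + 2)) v) with hc
  by_cases hc1 : c + 1 = 0
  · refine isOrthNilClean_of_cyclic_of_eq_zero (h := 0) hspan' hφ hφk hψ hψm hψl ht
      (map_zero _) (map_zero _) ?_
    rw [map_zero, ← hc, hc1, zero_smul]
  -- In dimension two the conditions on `h` force `h = 0`, which fails when `c + 1 ≠ 0`; but there
  -- `A * A = c • 1`. Otherwise `(c + 1) • (A ^ j) v` serves.
  rcases m with _ | j
  · have hA2 : (A ^ 2) v = c • v := by
      have h := b.sum_repr ((A ^ 2) v)
      rw [Fin.sum_univ_two] at h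
      have h0 : b.repr ((A ^ 2) v) 0 = c := rfl
      have h1 : b.repr ((A ^ 2) v) 1 = 0 := ht
      rw [h0, h1, zero_smul, add_zero, hbe] at h
      simpa using h.symm
    have hAA : A * A = c • 1 := by
      refine LinearMap.ext_on hspan' ?_
      rintro _ ⟨i, hi, rfl⟩
      simp only
      rw [← pow_two, ← Module.End.mul_apply, ← pow_add, add_comm, pow_add, Module.End.mul_apply,
        hA2, map_smul, LinearMap.smul_apply, Module.End.one_apply]
    rcases hF c with h0 | h1 | h1
    · exact IsNilpotent.isOrthNilClean ⟨2, by rw [pow_two, hAA, h0, zero_smul]⟩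
    · refine isOrthNilClean_of_mul_self_eq_one (by rw [hAA, h1, one_smul]) ?_
      rw [h1, one_add_one_eq_two] at hc1
      exact hc1
    · exact absurd (by rw [h1, neg_add_cancel]) hc1
  · refine isOrthNilClean_of_cyclic_of_eq_zero (h := (c + 1) • (A ^ j) v) hspan' hφ hφk hψ hψm hψl
      ht ?_ ?_ ?_
    · rw [map_smul, hφ j (by omega), smul_zero]
    · rw [map_smul, hψ j (by omega), smul_zero]
    · rw [map_smul, ← Module.End.mul_apply, ← pow_succ']

/-- The Krylov subspace of a nonzero vector. -/
theorem exists_cyclic_basis {V : Type*} [AddCommGroup V] [Module F V] [Module.Finite F V]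
    (A : Module.End F V) {v : V} (hv : v ≠ 0) :
    ∃ k : ℕ, LinearIndependent F (fun i : Fin (k + 1) => (A ^ (i : ℕ)) v) ∧
      (A ^ (k + 1)) v ∈ Submodule.span F (Set.range fun i : Fin (k + 1) => (A ^ (i : ℕ)) v) := by
  classical
  have hex : ∃ k : ℕ, ¬ LinearIndependent F (fun i : Fin (k + 1) => (A ^ (i : ℕ)) v) :=
    ⟨Module.finrank F V, fun h => by
      have := h.fintype_card_le_finrank
      simp at this⟩
  rcases hk : Nat.find hex with _ | k
  · refine absurd ?_ (hk ▸ Nat.find_spec hex)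
    have : Unique (Fin (0 + 1)) := inferInstanceAs (Unique (Fin 1))
    rw [linearIndependent_unique_iff]
    simpa using hv
  · have h1 : ¬ LinearIndependent F (fun i : Fin (k + 1 + 1) => (A ^ (i : ℕ)) v) :=
      hk ▸ Nat.find_spec hex
    have h2 : LinearIndependent F (fun i : Fin (k + 1) => (A ^ (i : ℕ)) v) :=
      not_not.mp (Nat.find_min hex (m := k) (by omega))
    refine ⟨k, h2, ?_⟩
    rw [linearIndependent_finSucc'] at h1
    by_contra hcon
    exact h1 ⟨h2, hcon⟩

/-- The Krylov subspace of a nonzero vector is invariant; on a complement, the compression of `A`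
has smaller dimension. -/
theorem isOrthNilClean_end (hF : ∀ a : F, a = 0 ∨ a = 1 ∨ a = -1) (n : ℕ) :
    ∀ (V : Type*) [AddCommGroup V] [Module F V] [Module.Finite F V], Module.finrank F V = n →
      ∀ A : Module.End F V, IsOrthNilClean A := by
  induction n using Nat.strong_induction_on with
  | _ n ih =>
    intro V _ _ _ hn A
    rcases subsingleton_or_nontrivial V with hV | hV
    · rw [Subsingleton.elim A 0]
      exact IsNilpotent.zero.isOrthNilClean
    obtain ⟨v, hv⟩ := exists_ne (0 : V)
    obtain ⟨k, hli, hmem⟩ := exists_cyclic_basis A hv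
    set U := Submodule.span F (Set.range fun i : Fin (k + 1) => (A ^ (i : ℕ)) v) with hU
    have hsub : ∀ i : Fin (k + 1), (A ^ (i : ℕ)) v ∈ U := fun i =>
      Submodule.subset_span ⟨i, rfl⟩
    have hAU : ∀ u ∈ U, A u ∈ U := by
      intro u hu
      refine (Submodule.span_le.mpr ?_ : U ≤ U.comap A) hu
      rintro _ ⟨i, rfl⟩
      change A ((A ^ (i : ℕ)) v) ∈ U
      rw [← Module.End.mul_apply, ← pow_succ']
      rcases Nat.lt_or_ge (i + 1 : ℕ) (k + 1) with h | h
      · exact hsub ⟨i + 1, h⟩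
      · rw [show (i + 1 : ℕ) = k + 1 by omega]
        exact hmem
    have hvU : v ∈ U := hsub 0
    have hpow : ∀ i, ((((A.restrict hAU) ^ i) ⟨v, hvU⟩ : U) : V) = (A ^ i) v := by
      intro i
      induction i with
      | zero => simp
      | succ i ih => rw [pow_succ', pow_succ', Module.End.mul_apply, Module.End.mul_apply,
          LinearMap.coe_restrict_apply, ih]
    have hC : IsOrthNilClean (A.restrict hAU) := by
      refine isOrthNilClean_of_cyclic hF (v := ⟨v, hvU⟩) (k := k) ?_ ?_
      · refine LinearIndependent.of_comp U.subtype ?_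
        convert hli using 2 with i
        exact hpow i
      · apply Submodule.map_injective_of_injective U.injective_subtype
        rw [Submodule.map_span, ← Set.range_comp, Submodule.map_top, Submodule.range_subtype]
        exact congrArg (fun g => Submodule.span F (Set.range g)) (funext fun i => hpow i)
    obtain ⟨U', hUU'⟩ := U.exists_isCompl
    have hlt : Module.finrank F U' < n := by
      have h1 := Submodule.finrank_add_eq_of_isCompl hUU'
      have h2 : 0 < Module.finrank F U := by
        have : Nontrivial U := ⟨⟨v, hvU⟩, 0, fun h => hv (congrArg Subtype.val h)⟩
        exact Module.finrank_pos
      omega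
    set e := U.prodEquivOfIsCompl U' hUU' with he
    set B : Module.End F (U × U') := e.symm.conj A with hB
    have hBu : ∀ u, B (u, 0) = (A.restrict hAU u, 0) := by
      intro u
      rw [hB, LinearEquiv.conj_apply_apply, LinearEquiv.symm_symm, LinearEquiv.symm_apply_eq]
      simp [he]
    have h := IsOrthNilClean.of_prod (B := B)
      (D := (LinearMap.snd F U U') ∘ₗ B ∘ₗ (LinearMap.inr F U U')) hBu ?_ hC (ih _ hlt U' rfl _)
    · have hA := h.map e.conjRingEquiv
      convert hA
      ext x
      simp [hB]
    · rintro ⟨u, u'⟩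
      have : ((u, u') : U × U') = (u, 0) + (0, u') := by simp
      rw [this, map_add, hBu]
      simp

theorem isOrthNilClean_matrix_field (hF : ∀ a : F, a = 0 ∨ a = 1 ∨ a = -1) {n : Type*} [Fintype n]
    [DecidableEq n] (A : Matrix n n F) : IsOrthNilClean A := by
  have h := (isOrthNilClean_end hF _ (n → F) rfl (Matrix.toLinAlgEquiv' A)).map
    (Matrix.toLinAlgEquiv' (R := F) (n := n)).symm
  simpa using h

end Cyclic

/-! ### Matrices over commutative rings with `a ^ 3 = a`, and lifting. -/

section Matrix

theorem IsOrthNilClean.pi {ι : Type*} [Finite ι] {S : ι → Type*} [∀ i, Ring (S i)] {a : ∀ i, S i}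
    (h : ∀ i, IsOrthNilClean (a i)) : IsOrthNilClean a := by
  cases nonempty_fintype ι
  choose p q hp hq hpq hqp k hk using h
  refine ⟨p, q, funext hp, funext hq, funext hpq, funext hqp, ∑ i, k i, funext fun i => ?_⟩
  exact pow_eq_zero_of_le (Finset.single_le_sum (fun _ _ => Nat.zero_le _) (Finset.mem_univ i))
    (hk i)

/-- Matrices over a product of rings as a product of matrix rings. -/
def Matrix.ofPiRingHom {ι n : Type*} [Fintype n] [DecidableEq n] (S : ι → Type*)
    [∀ i, Ring (S i)] : (∀ i, Matrix n n (S i)) →+* Matrix n n (∀ i, S i) where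
  toFun M := Matrix.of fun j k i => M i j k
  map_one' := by ext j k i; by_cases h : j = k <;> simp [Matrix.one_apply, h]
  map_mul' M N := by ext j k i; simp [Matrix.mul_apply]
  map_zero' := rfl
  map_add' M N := rfl

variable {n : Type*} [Fintype n] [DecidableEq n]

/-- A finite reduced commutative ring is the product of its residue fields. -/
theorem isOrthNilClean_matrix_of_finite {K : Type*} [CommRing K] [Finite K]
    (h : ∀ a : K, a ^ 3 = a) (A : Matrix n n K) : IsOrthNilClean A := by
  have : IsReduced K := by
    rw [isReduced_iff_pow_one_lt 2 one_lt_two]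
    intro x hx
    rw [← h x, pow_succ, hx, zero_mul]
  have hfield : ∀ I : MaximalSpectrum K, ∀ A : Matrix n n (K ⧸ I.asIdeal), IsOrthNilClean A := by
    intro I A
    let := Ideal.Quotient.field I.asIdeal
    refine isOrthNilClean_matrix_field (fun a => ?_) A
    obtain ⟨x, rfl⟩ := Ideal.Quotient.mk_surjective a
    have hx := congrArg (Ideal.Quotient.mk I.asIdeal) (h x)
    rw [map_pow] at hx
    generalize Ideal.Quotient.mk I.asIdeal x = a at hx
    have : a * ((a - 1) * (a + 1)) = 0 := by linear_combination hx
    rcases mul_eq_zero.mp this with h | h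
    · exact Or.inl h
    rcases mul_eq_zero.mp h with h | h
    · exact Or.inr (Or.inl (sub_eq_zero.mp h))
    · exact Or.inr (Or.inr (eq_neg_of_add_eq_zero_left h))
  let e := IsArtinianRing.equivPi K
  have h1 := (IsOrthNilClean.pi fun I =>
    hfield I (A.map (Ideal.Quotient.mk I.asIdeal))).map
      (Matrix.ofPiRingHom (n := n) fun I : MaximalSpectrum K => K ⧸ I.asIdeal)
  have h2 := h1.map (e.symm.toRingEquiv.toRingHom.mapMatrix (m := n))
  convert h2
  ext i j
  change A i j = e.symm _
  rw [AlgEquiv.eq_symm_apply]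
  ext I
  rfl

/-- The subring generated by the entries is finite: its generators are roots of the monic `X ^ 3 -
X`, so it is a finite `ℤ`-module, and `6 = 2 ^ 3 - 2` kills it. -/
theorem isOrthNilClean_matrix_of_cube_eq_self {K : Type*} [CommRing K]
    (h : ∀ a : K, a ^ 3 = a) (A : Matrix n n K) : IsOrthNilClean A := by
  let s : Set K := Set.range fun ij : n × n => A ij.1 ij.2
  let S := Algebra.adjoin ℤ s
  have hS : ∀ a : S, a ^ 3 = a := fun a => Subtype.ext (h a)
  have hfg : Module.Finite ℤ S := by
    refine Module.Finite.of_fg (N := Subalgebra.toSubmodule S) ?_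
    refine fg_adjoin_of_finite (Set.finite_range _) fun x _ => ?_
    refine ⟨Polynomial.X ^ 3 - Polynomial.X, ?_, by simp [h x]⟩
    exact Polynomial.monic_X_pow_sub (by simp)
  have h6 : (6 : S) = 0 := by
    have := hS 2
    linear_combination this
  have hfin : Finite S := by
    refine Module.finite_of_fg_torsion S fun {x} => ⟨⟨6, by simp⟩, ?_⟩
    change (6 : ℤ) • x = 0
    rw [zsmul_eq_mul]
    push_cast
    rw [h6, zero_mul]
  have h1 := (isOrthNilClean_matrix_of_finite hS
    (Matrix.of fun i j => (⟨A i j, Algebra.subset_adjoin ⟨(i, j), rfl⟩⟩ : S))).map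
      (S.val.toRingHom.mapMatrix (m := n))
  exact h1

theorem IsOrthNilClean.lift {S T : Type*} [Ring S] [Ring T] {f : S →+* T}
    (hf : Function.Surjective f) (hker : ∀ x ∈ RingHom.ker f, IsNilpotent x) {a : S}
    (h : IsOrthNilClean (f a)) : IsOrthNilClean a := by
  obtain ⟨p, q, hp, hq, hpq, hqp, k, hk⟩ := h
  have ho : OrthogonalIdempotents ![p, q] := by
    refine ⟨fun i => by fin_cases i <;> assumption, fun i j hij => ?_⟩
    fin_cases i <;> fin_cases j <;> first | exact absurd rfl hij | assumption
  obtain ⟨e, he, hfe⟩ := ho.lift_of_isNilpotent_ker f hker fun i => hf _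
  have h0 : f (e 0) = p := congrFun hfe 0
  have h1 : f (e 1) = q := congrFun hfe 1
  refine ⟨e 0, e 1, he.idem 0, he.idem 1, he.ortho (by decide), he.ortho (by decide), ?_⟩
  refine IsNilpotent.of_pow (m := k) (hker _ ?_)
  rw [RingHom.mem_ker, map_pow, map_sub, map_sub, h0, h1, hk]

theorem IsOrthNilClean.exists_tripotent {S : Type*} [Ring S] {a : S} (h : IsOrthNilClean a) :
    ∃ e w : S, IsTripotentElem e ∧ IsNilpotent w ∧ a = e + w := by
  obtain ⟨p, q, hp, hq, hpq, hqp, hn⟩ := h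
  refine ⟨p - q, a - (p - q), ?_, hn, by abel⟩
  rw [IsTripotentElem, pow_succ, pow_two]
  simp only [sub_mul, mul_sub, hp.eq, hq.eq, hpq, hqp]
  simp

end Matrix

theorem theorem4p9 {R : Type*} [Ring R] (hb : IsOfBoundedIndex R)
    (hs : IsStronglyTwoNilClean R) (n : ℕ) :
    IsTrinilClean (Matrix (Fin n) (Fin n) R) := by
  intro A
  obtain ⟨m, hm⟩ := hb
  have hcube := hs.isNilpotent_sub_cube
  have hJ : ∀ x ∈ Ring.jacobson R, x ^ m = 0 := fun x hx =>
    hm x (isNilpotent_of_mem_jacobson hcube hx)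
  have hK := cube_eq_self_quotient_jacobson hcube
  let : CommRing (R ⧸ Ring.jacobson R) :=
    { (inferInstance : Ring (R ⧸ Ring.jacobson R)) with mul_comm := mul_comm_of_cube_eq_self hK }
  refine (IsOrthNilClean.lift (f := (Ideal.Quotient.mk (Ring.jacobson R)).mapMatrix)
    ?_ ?_ (isOrthNilClean_matrix_of_cube_eq_self hK _)).exists_tripotent
  · exact fun M => ⟨M.map (Function.surjInv Ideal.Quotient.mk_surjective), by
      ext i j; exact Function.surjInv_eq Ideal.Quotient.mk_surjective _⟩
  · intro M hM
    refine isNilpotent_of_mem_matrix hJ fun i j => ?_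
    refine Ideal.Quotient.eq_zero_iff_mem.mp ?_
    exact Matrix.ext_iff.mpr (RingHom.mem_ker.mp hM) i j
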